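/- All spaces are $T_1$; zero-dimensional means $T_1$ with a base of clopen sets. For a property $P$ of subspaces, a space $X$ is $P$-bounded if every subspace of $X$ with property $P$ has compact closure in $X$; we use this for $\omega$ ("countable"), $\omega N$ ("countable and nowhere dense in the ambient space") and $C_2$ ("second countable"). For $Y\subseteq Z$, the $\omega N$-closure of $Y$ in $Z$ is $\mathrm{cl}^{\omega N}_Z(Y)=\bigcup\{\overline{A}^{Z} : A\subseteq Y,\ A \text{ countable and nowhere dense in } Z\}$. A space is nodec if each of its nowhere dense subsets is closed. Let $L$ be the one-point compactification, with point at infinity $y$, of $\omega_1\times 2^{\omega}$ (where $\omega_1$ carries the order topology), and for a space $X$ with compactification $cX$ let $M(X,cX)=\big[cX\times(L\setminus\{y\})\big]\cup\big(X\times\{y\}\big)$, a subspace of $cX\times L$. Then (in ZFC) the Cantor cube $2^{\mathfrak c}$ has a countable dense subspace that is nodec. Moreover, for every countable dense nodec subspace $S$ of $2^{\mathfrak c}$ and every $a\in S$, the subspace $X=\mathrm{cl}^{\omega N}_{2^{\mathfrak c}}(S\setminus\{a\})$ of $2^{\mathfrak c}$ is zero-dimensional, $\omega N$-bounded and $C_2$-bounded,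 but not $\omega$-bounded; $X$ is dense in $2^{\mathfrak c}$, so $2^{\mathfrak c}$ is a compactification of $X$; and the space $M(X,2^{\mathfrak c})$ is zero-dimensional and $C_2$-bounded but not $\omega N$-bounded. -/

import Mathlib

open Set TopologicalSpace

/-- Given a property `P` of subspaces of `X`, the space `X` is `P`-bounded iff every subspace
with property `P` has compact closure in `X`. -/
def PBounded (X : Type*) [TopologicalSpace X] (P : Set X → Prop) : Prop :=
  ∀ A : Set X, P A → IsCompact (closure A)

/-- The property `ωN`: countable and nowhere dense (in the ambient space). -/
def OmegaN {X : Type*} [TopologicalSpace X] (A : Set X) : Prop :=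
  A.Countable ∧ IsNowhereDense A

/-- The property `C₂`: second countable in the subspace topology. -/
def SecondCountableSubspace {X : Type*} [TopologicalSpace X] (A : Set X) : Prop :=
  SecondCountableTopology A

/-- `ω`-bounded: every countable set has compact closure. -/
def OmegaBounded (X : Type*) [TopologicalSpace X] : Prop :=
  PBounded X fun A => A.Countable

/-- `ωN`-bounded: every countable nowhere dense set has compact closure. -/
def OmegaNBounded (X : Type*) [TopologicalSpace X] : Prop :=
  PBounded X OmegaN

/-- `C₂`-bounded: every second countable subspace has compact closure. -/
def C2Bounded (X : Type*) [TopologicalSpace X] : Prop :=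
  PBounded X SecondCountableSubspace

/-- The `P`-closure of `Y` in `X`: the union of the closures (in `X`) of all subsets of `Y`
that have property `P` (as subspaces of `X`). -/
def pClosure {X : Type*} [TopologicalSpace X] (P : Set X → Prop) (Y : Set X) : Set X :=
  ⋃ A ∈ {A : Set X | A ⊆ Y ∧ P A}, closure A

/-- A space is nodec if all its nowhere dense subsets are closed. -/
def Nodec (X : Type*) [TopologicalSpace X] : Prop :=
  ∀ A : Set X, IsNowhereDense A → IsClosed A

/-- Zero-dimensional: `T₁` with a base of clopen sets. -/
def ZeroDimensional (X : Type*) [TopologicalSpace X] : Prop :=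
  T1Space X ∧ IsTopologicalBasis {U : Set X | IsClopen U}

/-- The long Cantor set: the one-point compactification of `ω₁ × C`, where `ω₁` has the order
topology and `C = 2^ℕ` is the Cantor set. -/
abbrev LongCantor : Type 1 :=
  OnePoint (Iio (Ordinal.omega 1 : Ordinal.{0}) × (ℕ → Bool))

/-- The construction `M(X, K)` for a subspace `X` of `K` (where `K` is a compactification of `X`):
the subspace `(K × (Y \ {y})) ∪ (X × {y})` of `K × Y`, with `Y` the long Cantor set and
`y` its point at infinity. -/
def mSpace {K : Type*} (X : Set K) : Set (K × LongCantor) :=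
  (univ ×ˢ {OnePoint.infty}ᶜ) ∪ (X ×ˢ {OnePoint.infty})

/-!
To make a countable dense subset `D` of `2^𝔠` nodec, alter its points one coordinate at a time:
the coordinate indexed by `(A, p)`, with `A ⊆ D` nowhere dense and `p ∉ A`, is set to `0` on `A` and
to `1` at `p`. Each coordinate changes only on a nowhere dense set, so on every basic open set only
a nowhere dense set of points is misplaced; density and nowhere density survive, while every
nowhere dense set becomes closed.

A nodec dense set `S` omits `a` from `cl^{ωN}(S \ {a})`, so this proper dense subspace `X` is not
`ω`-bounded. It is `ωN`-bounded: if `B ⊆ X` is countable and nowhere dense, the countable nowhere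
dense sets `A_b` with `b ∈ closure A_b` can be shrunk to neighbourhoods of `b` so that they are
locally finite at a dense set of points off `closure B`; their union is then still nowhere dense.
Points of `X` have uncountable character, so second countable subspaces are nowhere dense and
`C₂`-boundedness follows. In `M(X, 2^𝔠)` a separable set off the slice `X × {y}` stays away from
`y`, because `ω₁ × 2^ω` is `ω`-bounded, whereas the slice itself is a closed nowhere dense copy
of `X`.
-/

open Topology

section NowhereDense

variable {X : Type*} [TopologicalSpace X] {s t : Set X}

theorem exists_isOpen_subset_disjoint (hs : IsNowhereDense s) {U : Set X} (hU : IsOpen U)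
    (hne : U.Nonempty) : ∃ V ⊆ U, IsOpen V ∧ V.Nonempty ∧ Disjoint V s := by
  refine ⟨U \ closure s, sdiff_subset, hU.sdiff isClosed_closure, ?_,
    disjoint_sdiff_left.mono_right subset_closure⟩
  by_contra hempty
  rw [not_nonempty_iff_eq_empty, sdiff_eq_empty] at hempty
  have hsub : U ⊆ interior (closure s) := interior_maximal hempty hU
  rw [hs] at hsub
  exact hne.not_subset_empty hsub

theorem isNowhereDense_of_forall_exists_inter
    (h : ∀ U : Set X, IsOpen U → U.Nonempty →
      ∃ O ⊆ U, IsOpen O ∧ O.Nonempty ∧ IsNowhereDense (O ∩ s)) :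
    IsNowhereDense s := by
  by_contra hs
  obtain ⟨O, hOs, hO, hne, hN⟩ := h _ isOpen_interior (nonempty_iff_ne_empty.mpr hs)
  have hsub : O ⊆ interior (closure (O ∩ s)) := interior_maximal
    (fun x hx => hO.inter_closure ⟨hx, interior_subset (hOs hx)⟩) hO
  rw [hN] at hsub
  exact hne.not_subset_empty hsub

theorem isNowhereDense_union (hs : IsNowhereDense s) (ht : IsNowhereDense t) :
    IsNowhereDense (s ∪ t) := by
  rw [IsNowhereDense, closure_union,
    interior_union_isClosed_of_interior_empty isClosed_closure ht, hs]

theorem isNowhereDense_biUnion {α : Type*} {I : Set α} (hI : I.Finite) {A : α → Set X}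
    (hA : ∀ i ∈ I, IsNowhereDense (A i)) : IsNowhereDense (⋃ i ∈ I, A i) := by
  induction I, hI using Set.Finite.induction_on with
  | empty => simp only [mem_empty_iff_false, iUnion_of_empty, iUnion_empty, isNowhereDense_empty]
  | insert _ _ ih =>
    rw [biUnion_insert]
    exact isNowhereDense_union (hA _ (mem_insert _ _))
      (ih fun i hi => hA i (mem_insert_of_mem _ hi))

theorem isNowhereDense_iUnion_of_dense_locallyFinite {α : Type*} {A : α → Set X}
    (hA : ∀ i, IsNowhereDense (A i))
    (hd : Dense {x | ∃ V ∈ 𝓝 x, {i | (A i ∩ V).Nonempty}.Finite}) :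
    IsNowhereDense (⋃ i, A i) := by
  refine isNowhereDense_of_forall_exists_inter fun U hU hne => ?_
  obtain ⟨x, hxU, V, hV, hfin⟩ := hd.inter_open_nonempty U hU hne
  refine ⟨U ∩ interior V, inter_subset_left, hU.inter isOpen_interior,
    ⟨x, hxU, mem_interior_iff_mem_nhds.mpr hV⟩,
    (isNowhereDense_biUnion hfin fun i _ => hA i).mono ?_⟩
  rintro y ⟨⟨-, hyV⟩, hyA⟩
  obtain ⟨i, hi⟩ := mem_iUnion.mp hyA
  exact mem_biUnion (show i ∈ {i | (A i ∩ V).Nonempty} from ⟨y, hi, interior_subset hyV⟩) hi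

theorem isNowhereDense_preimage_of_isDenseInducing {Y : Type*} [TopologicalSpace Y] {f : Y → X}
    (hf : IsDenseInducing f) (hs : IsNowhereDense s) : IsNowhereDense (f ⁻¹' s) := by
  refine isNowhereDense_of_forall_exists_inter fun U hU ⟨y, hy⟩ => ?_
  obtain ⟨U', hU', rfl⟩ := hf.isInducing.isOpen_iff.mp hU
  obtain ⟨V, hVU, hV, hVne, hVs⟩ := exists_isOpen_subset_disjoint hs hU' ⟨f y, hy⟩
  obtain ⟨z, hz⟩ := hf.dense.exists_mem_open hV hVne
  refine ⟨f ⁻¹' V, preimage_mono hVU, hV.preimage hf.continuous, ⟨z, hz⟩, ?_⟩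
  rw [← preimage_inter, hVs.inter_eq, preimage_empty]
  exact isNowhereDense_empty

theorem isNowhereDense_singleton [T1Space X] (x : X) [(𝓝[≠] x).NeBot] :
    IsNowhereDense ({x} : Set X) := by
  rw [isClosed_singleton.isNowhereDense_iff, interior_singleton]

end NowhereDense

section Character

theorem nhdsNE_neBot_of_not_isCountablyGenerated {X : Type*} [TopologicalSpace X] {x : X}
    (hx : ¬ (𝓝 x).IsCountablyGenerated) : (𝓝[≠] x).NeBot := by
  refine ⟨fun h => hx ?_⟩
  rw [← pure_sup_nhdsNE, h, sup_bot_eq]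
  infer_instance

theorem isCountablyGenerated_nhds_of_isDenseInducing {X Y : Type*} [TopologicalSpace X]
    [TopologicalSpace Y] [RegularSpace Y] {f : X → Y} (hf : IsDenseInducing f) (x : X)
    [(𝓝 x).IsCountablyGenerated] : (𝓝 (f x)).IsCountablyGenerated :=
  have ⟨_, hV⟩ := (𝓝 x).exists_antitone_basis
  (hV.toHasBasis.hasBasis_of_isDenseInducing hf).isCountablyGenerated

/- A point `x` of `B` has countable character in `closure B`, which is a neighbourhood of `x`
as soon as `x` lies in its interior. -/
theorem isNowhereDense_of_firstCountableTopology {X : Type*} [TopologicalSpace X] [RegularSpace X]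
    (hX : ∀ x : X, ¬ (𝓝 x).IsCountablyGenerated) (B : Set X) [FirstCountableTopology B] :
    IsNowhereDense B := by
  by_contra hB
  obtain ⟨x, hxB, hx⟩ : (B ∩ interior (closure B)).Nonempty := by
    rw [← closure_inter_open_nonempty_iff isOpen_interior, inter_eq_right.mpr interior_subset]
    exact nonempty_iff_ne_empty.mpr hB
  have hdense : IsDenseInducing (inclusion (subset_closure (s := B))) :=
    ⟨(IsEmbedding.inclusion _).isInducing, (denseRange_inclusion_iff _).mpr subset_rfl⟩
  have hclosure := isCountablyGenerated_nhds_of_isDenseInducing hdense ⟨x, hxB⟩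
  apply hX x
  rw [← map_nhds_subtype_coe_eq_nhds (subset_closure hxB) (mem_interior_iff_mem_nhds.mp hx)]
  exact Filter.map.isCountablyGenerated _ _

theorem countable_of_isCountablyGenerated_pi {ι : Type*} {X : ι → Type*}
    {f : ∀ i, Filter (X i)} [∀ i, (f i).NeBot] (hf : ∀ i, f i ≠ ⊤)
    [(Filter.pi f).IsCountablyGenerated] : Countable ι := by
  classical
  obtain ⟨V, hV⟩ := (Filter.pi f).exists_antitone_basis
  have hproper : ∀ i, ∃ s ∈ f i, s ≠ univ := by
    intro i
    by_contra! h
    exact hf i (top_unique fun s hs => Filter.mem_top.mpr (h s hs))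
  choose s hs hsne using hproper
  have hsub : ∀ i, ∃ n, V n ⊆ Function.eval i ⁻¹' s i := fun i =>
    hV.mem_iff.mp (Filter.tendsto_eval_pi f i (hs i))
  choose I t ht hIV using fun n => Filter.mem_pi'.mp (hV.mem n)
  have hcover : (⋃ n, (I n : Set ι)) = univ := by
    refine eq_univ_of_forall fun i => ?_
    obtain ⟨n, hn⟩ := hsub i
    refine mem_iUnion_of_mem n ?_
    by_contra hi
    obtain ⟨z, hz⟩ : ((I n : Set ι).pi (t n)).Nonempty :=
      pi_nonempty_iff.mpr fun j => (Filter.nonempty_of_mem (ht n j)).imp fun _ h _ => h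
    refine hsne i (eq_univ_of_forall fun y => ?_)
    have hy : Function.update z i y ∈ V n := hIV n fun j hj => by
      rw [Function.update_of_ne (ne_of_mem_of_not_mem hj hi)]
      exact hz j hj
    simpa only [mem_preimage, Function.eval, Function.update_self] using hn hy
  exact countable_univ_iff.mp (hcover ▸ countable_iUnion fun n => (I n).countable_toSet)

theorem not_isCountablyGenerated_nhds_pi {ι : Type*} [Uncountable ι] {X : ι → Type*}
    [∀ i, TopologicalSpace (X i)] [∀ i, T1Space (X i)] [∀ i, Nontrivial (X i)] (x : ∀ i, X i) :
    ¬ (𝓝 x).IsCountablyGenerated := by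
  have hx : ∀ i, 𝓝 (x i) ≠ ⊤ := by
    intro i h
    obtain ⟨y, hy⟩ := exists_ne (x i)
    have hmem : ({y}ᶜ : Set (X i)) ∈ 𝓝 (x i) := compl_singleton_mem_nhds hy.symm
    rw [h, Filter.mem_top] at hmem
    exact (hmem ▸ mem_univ y : y ∈ ({y}ᶜ : Set (X i))) rfl
  rw [nhds_pi]
  exact fun _ => not_countable (countable_of_isCountablyGenerated_pi hx)

end Character

section PClosure

variable {X : Type*} [TopologicalSpace X]

theorem mem_pClosure_iff {P : Set X → Prop} {Y : Set X} {x : X} :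
    x ∈ pClosure P Y ↔ ∃ A ⊆ Y, P A ∧ x ∈ closure A := by
  simp only [pClosure, mem_ofPred_eq, mem_iUnion, exists_prop, and_assoc]

theorem closure_subset_pClosure {P : Set X → Prop} {Y A : Set X} (hAY : A ⊆ Y) (hA : P A) :
    closure A ⊆ pClosure P Y :=
  fun _ hx => mem_pClosure_iff.mpr ⟨A, hAY, hA, hx⟩

theorem subset_pClosure_omegaN [T1Space X] [∀ x : X, (𝓝[≠] x).NeBot] (Y : Set X) :
    Y ⊆ pClosure OmegaN Y := fun y hy =>
  closure_subset_pClosure (singleton_subset_iff.mpr hy)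
    ⟨countable_singleton y, isNowhereDense_singleton y⟩ (subset_closure rfl)

/- Enumerate both families; `U i` avoids the neighbourhoods of the finitely many `s k` that come
before `b i`. -/
theorem exists_isOpen_finite_setOf_inter_nonempty [RegularSpace X] {α β : Type*} [Countable α]
    [Countable β] {b : α → X} {s : β → X} (hs : ∀ k, s k ∉ closure (range b)) :
    ∃ U : α → Set X, (∀ i, IsOpen (U i) ∧ b i ∈ U i) ∧
      ∀ k, ∃ V ∈ 𝓝 (s k), {i | (U i ∩ V).Nonempty}.Finite := by
  obtain ⟨e, he⟩ := Countable.exists_injective_nat α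
  obtain ⟨f, hf⟩ := Countable.exists_injective_nat β
  have hsep : ∀ k, ∃ V ∈ 𝓝 (s k), IsClosed V ∧ V ⊆ (closure (range b))ᶜ := fun k =>
    exists_mem_nhds_isClosed_subset (isClosed_closure.isOpen_compl.mem_nhds (hs k))
  choose V hVs hV hVb using hsep
  have hfin : ∀ i, {k | f k ≤ e i}.Finite := fun i => (finite_Iic (e i)).preimage hf.injOn
  refine ⟨fun i => ⋂ k ∈ {k | f k ≤ e i}, (V k)ᶜ, fun i => ⟨?_, ?_⟩, fun k => ⟨V k, hVs k, ?_⟩⟩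
  · exact (hfin i).isOpen_biInter fun k _ => (hV k).isOpen_compl
  · exact mem_iInter₂.mpr fun k _ hb => hVb k hb (subset_closure (mem_range_self i))
  · refine ((finite_Iio (f k)).preimage he.injOn).subset ?_
    rintro i ⟨x, hxU, hxV⟩
    by_contra hki
    have hle : f k ≤ e i := not_lt.mp hki
    exact mem_iInter₂.mp hxU k hle hxV

theorem exists_omegaN_subset_closure [RegularSpace X] [SeparableSpace X] {Y B : Set X}
    (hBY : B ⊆ pClosure OmegaN Y) (hB : OmegaN B) : ∃ A ⊆ Y, OmegaN A ∧ B ⊆ closure A := by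
  obtain ⟨S, hSc, hSd⟩ := exists_countable_dense X
  have : Countable B := hB.1.to_subtype
  have : Countable (S \ closure B : Set X) := (hSc.mono sdiff_subset).to_subtype
  choose A hAY hA hbA using fun b : B => mem_pClosure_iff.mp (hBY b.2)
  obtain ⟨U, hU, hfin⟩ := exists_isOpen_finite_setOf_inter_nonempty (b := ((↑) : B → X))
    (s := ((↑) : (S \ closure B : Set X) → X)) (by rw [Subtype.range_coe]; exact fun s => s.2.2)
  have hdense : Dense (S \ closure B) :=
    hSd.inter_of_isOpen_right (interior_eq_empty_iff_dense_compl.mp hB.2)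
      isClosed_closure.isOpen_compl
  refine ⟨⋃ b, U b ∩ A b, iUnion_subset fun b => inter_subset_right.trans (hAY b),
    ⟨countable_iUnion fun b => (hA b).1.mono inter_subset_right, ?_⟩, fun b hb => ?_⟩
  · refine isNowhereDense_iUnion_of_dense_locallyFinite
      (fun b => (hA b).2.mono inter_subset_right) (hdense.mono fun s hs => ?_)
    obtain ⟨V, hV, hVfin⟩ := hfin ⟨s, hs⟩
    exact ⟨V, hV, hVfin.subset fun b hb =>
      hb.mono (inter_subset_inter_left _ inter_subset_left)⟩
  · exact closure_mono (subset_iUnion _ (⟨b, hb⟩ : B))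
      ((hU ⟨b, hb⟩).1.inter_closure ⟨(hU ⟨b, hb⟩).2, hbA ⟨b, hb⟩⟩)

theorem Nodec.notMem_pClosure_omegaN {S : Set X} (hS : Nodec S) (hSd : Dense S) {a : X}
    (ha : a ∈ S) : a ∉ pClosure OmegaN (S \ {a}) := by
  intro h
  obtain ⟨A, hAS, hA, haA⟩ := mem_pClosure_iff.mp h
  have hclosed : IsClosed ((↑) ⁻¹' A : Set S) :=
    hS _ (isNowhereDense_preimage_of_isDenseInducing hSd.isDenseInducing_val hA.2)
  have hmem : (⟨a, ha⟩ : S) ∈ closure ((↑) ⁻¹' A : Set S) := by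
    rwa [IsInducing.subtypeVal.closure_eq_preimage_closure_image, Subtype.image_preimage_coe,
      inter_eq_right.mpr (hAS.trans sdiff_subset)]
  exact (hAS (hclosed.closure_subset hmem)).2 rfl

end PClosure

section PBounded

variable {X : Type*} [TopologicalSpace X]

theorem isCompact_closure_subtype_iff [CompactSpace X] [T2Space X] {Y : Set X} {A : Set Y} :
    IsCompact (closure A) ↔ closure ((↑) '' A : Set X) ⊆ Y := by
  constructor
  · intro h
    have himage : IsCompact ((↑) '' closure A : Set X) := h.image continuous_subtype_val
    exact (closure_minimal (image_mono subset_closure) himage.isClosed).trans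
      (Subtype.coe_image_subset _ _)
  · intro h
    rw [IsInducing.subtypeVal.isCompact_iff,
      IsInducing.subtypeVal.closure_eq_preimage_closure_image,
      Subtype.image_preimage_coe, inter_eq_right.mpr h]
    exact isClosed_closure.isCompact

theorem zeroDimensional_subtype [CompactSpace X] [T2Space X] [TotallyDisconnectedSpace X]
    (Y : Set X) : ZeroDimensional Y := by
  refine ⟨inferInstance, isTopologicalBasis_of_isOpen_of_nhds (fun U hU => hU.isOpen) ?_⟩
  intro y U hy hU
  obtain ⟨U', hU', rfl⟩ := isOpen_induced_iff.mp hU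
  obtain ⟨V, hV, hyV, hVU⟩ := compact_exists_isClopen_in_isOpen hU' hy
  exact ⟨Subtype.val ⁻¹' V, hV.preimage continuous_subtype_val, hyV, preimage_mono hVU⟩

theorem omegaNBounded_pClosure_omegaN [CompactSpace X] [T2Space X] [SeparableSpace X]
    (Y : Set X) : OmegaNBounded (pClosure OmegaN Y) := by
  intro B hB
  obtain ⟨A, hAY, hA, hBA⟩ := exists_omegaN_subset_closure (Subtype.coe_image_subset _ B)
    ⟨hB.1.image _, hB.2.image_val⟩
  exact isCompact_closure_subtype_iff.mpr
    ((closure_minimal hBA isClosed_closure).trans (closure_subset_pClosure hAY hA))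

theorem OmegaNBounded.c2Bounded (hX : OmegaNBounded X)
    (hN : ∀ A : Set X, SecondCountableSubspace A → IsNowhereDense A) : C2Bounded X := by
  intro A (hA : SecondCountableTopology A)
  obtain ⟨T, hTc, hTd⟩ := exists_countable_dense A
  have hTA : ((↑) '' T : Set X) ⊆ A := Subtype.coe_image_subset _ _
  exact (hX _ ⟨hTc.image _, (hN A hA).mono hTA⟩).of_isClosed_subset isClosed_closure
    (closure_minimal (Subtype.dense_iff.mp hTd) isClosed_closure)

theorem eq_univ_of_omegaBounded [T2Space X] {Y D : Set X} (hY : OmegaBounded Y) (hDY : D ⊆ Y)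
    (hDc : D.Countable) (hDd : Dense D) : Y = univ := by
  have hcompact : IsCompact ((↑) '' closure ((↑) ⁻¹' D : Set Y) : Set X) :=
    (hY _ (hDc.preimage Subtype.val_injective)).image continuous_subtype_val
  have hD : D ⊆ (↑) '' closure ((↑) ⁻¹' D : Set Y) := fun x hx =>
    ⟨⟨x, hDY hx⟩, subset_closure hx, rfl⟩
  rw [← univ_subset_iff, ← hDd.closure_eq]
  exact (closure_minimal hD hcompact.isClosed).trans (Subtype.coe_image_subset _ _)

theorem OmegaBounded.prod {Y : Type*} [TopologicalSpace Y] (hX : OmegaBounded X)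
    (hY : OmegaBounded Y) : OmegaBounded (X × Y) := fun A (hA : A.Countable) =>
  ((hX _ (hA.image Prod.fst)).prod (hY _ (hA.image Prod.snd))).of_isClosed_subset isClosed_closure
    ((closure_mono subset_fst_image_prod_snd_image).trans closure_prod_eq.subset)

theorem secondCountableSubspace_preimage {Y : Type*} [TopologicalSpace Y] {f : Y → X}
    (hf : IsInducing f) {A : Set X} (hA : SecondCountableSubspace A) :
    SecondCountableSubspace (f ⁻¹' A) :=
  have : SecondCountableTopology A := hA
  (hf.restrictPreimage A).secondCountableTopology

end PBounded

section OnePoint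

variable {Z : Type*} [TopologicalSpace Z]

theorem infty_notMem_closure_of_isSeparable (hZ : OmegaBounded Z) {A : Set (OnePoint Z)}
    (hA : IsSeparable A) (hA' : OnePoint.infty ∉ A) : OnePoint.infty ∉ closure A := by
  obtain ⟨T, hTc, hAT⟩ := hA
  let B : Set Z := (↑) ⁻¹' T
  have hB : IsCompact (closure B) := hZ B (hTc.preimage OnePoint.coe_injective)
  have hclosed : IsClosed ((↑) '' closure B : Set (OnePoint Z)) :=
    OnePoint.isClosed_image_coe.mpr ⟨isClosed_closure, hB⟩
  have hTB : T ∩ {OnePoint.infty}ᶜ ⊆ (↑) '' closure B := by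
    rintro t ⟨ht, ht'⟩
    obtain ⟨z, rfl⟩ := OnePoint.ne_infty_iff_exists.mp ht'
    exact ⟨z, subset_closure ht, rfl⟩
  have hinfty : IsOpen ({OnePoint.infty}ᶜ : Set (OnePoint Z)) :=
    OnePoint.compl_infty ▸ OnePoint.isOpen_range_coe
  have hAB : A ⊆ (↑) '' closure B := fun x hx =>
    closure_minimal hTB hclosed (hinfty.closure_inter
      ⟨hAT hx, ne_of_mem_of_not_mem hx hA'⟩)
  exact fun h => OnePoint.infty_notMem_image_coe (closure_minimal hAB hclosed h)

theorem exists_isCompact_isClopen_subset [LocallyCompactSpace Z] [T2Space Z]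
    [TotallyDisconnectedSpace Z] {U : Set Z} (hU : IsOpen U) {z : Z} (hz : z ∈ U) :
    ∃ V ⊆ U, IsCompact V ∧ IsClopen V ∧ z ∈ V := by
  obtain ⟨K, hK, hzK, hKU⟩ := exists_compact_subset hU hz
  obtain ⟨V, hV, hzV, hVK⟩ := loc_compact_Haus_tot_disc_of_zero_dim.exists_subset_of_mem_open
    hzK isOpen_interior
  have hVK' : V ⊆ K := hVK.trans interior_subset
  exact ⟨V, hVK'.trans hKU, hK.of_isClosed_subset hV.1 hVK', hV, hzV⟩

theorem totallySeparatedSpace_onePoint [LocallyCompactSpace Z] [T2Space Z]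
    [TotallyDisconnectedSpace Z] : TotallySeparatedSpace (OnePoint Z) := by
  have hsep : ∀ (z : Z) (w : OnePoint Z), (z : OnePoint Z) ≠ w →
      ∃ U : Set (OnePoint Z), IsClopen U ∧ (z : OnePoint Z) ∈ U ∧ w ∉ U := by
    intro z w hzw
    obtain ⟨V, hVw, hVc, hV, hzV⟩ := exists_isCompact_isClopen_subset
      (isOpen_compl_singleton.preimage (OnePoint.continuous_coe (X := Z))) hzw
    refine ⟨(↑) '' V, ⟨OnePoint.isClosed_image_coe.mpr ⟨hV.1, hVc⟩,
      OnePoint.isOpen_image_coe.mpr hV.2⟩, mem_image_of_mem _ hzV, ?_⟩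
    rintro ⟨v, hv, rfl⟩
    exact hVw hv rfl
  rw [totallySeparatedSpace_iff_exists_isClopen]
  intro x y hxy
  induction x using OnePoint.rec with
  | coe x => exact hsep x y hxy
  | infty =>
    obtain ⟨z, rfl⟩ := OnePoint.ne_infty_iff_exists.mp hxy.symm
    obtain ⟨U, hU, hz, hinfty⟩ := hsep z _ hxy.symm
    exact ⟨Uᶜ, hU.compl, hinfty, not_not.mpr hz⟩

end OnePoint

section LinearOrder

variable {W : Type*} [LinearOrder W] [TopologicalSpace W] [OrderTopology W]

instance totallySeparatedSpace_of_succOrder [SuccOrder W] : TotallySeparatedSpace W := by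
  have hsep : ∀ a b : W, a < b → ∃ U : Set W, IsClopen U ∧ a ∈ U ∧ b ∈ Uᶜ := by
    intro a b hab
    refine ⟨Iic a, ⟨isClosed_Iic, ?_⟩, self_mem_Iic, hab.not_ge⟩
    rw [← Order.Iio_succ_of_not_isMax (not_isMax_of_lt hab)]
    exact isOpen_Iio
  rw [totallySeparatedSpace_iff_exists_isClopen]
  intro a b hab
  rcases hab.lt_or_gt with h | h
  · exact hsep a b h
  · obtain ⟨U, hU, hb, ha⟩ := hsep b a h
    exact ⟨Uᶜ, hU.compl, ha, not_not.mpr hb⟩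

instance compactIccSpace_of_ordConnected [CompactIccSpace W] {s : Set W} [OrdConnected s] :
    CompactIccSpace s := by
  refine ⟨fun {a b} => ?_⟩
  rw [IsInducing.subtypeVal.isCompact_iff, image_subtype_val_Icc]
  exact isCompact_Icc

theorem locallyCompactSpace_of_compactIccSpace [OrderBot W] [NoMaxOrder W] [CompactIccSpace W] :
    LocallyCompactSpace W := by
  have : WeaklyLocallyCompactSpace W := ⟨fun a =>
    have ⟨b, hab⟩ := exists_gt a
    ⟨Icc ⊥ b, isCompact_Icc, by rw [Icc_bot]; exact Iic_mem_nhds hab⟩⟩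
  infer_instance

theorem noncompactSpace_of_noMaxOrder [Nonempty W] [NoMaxOrder W] : NoncompactSpace W :=
  ⟨fun h => not_bddAbove_univ h.bddAbove⟩

theorem omegaBounded_of_countable_bddAbove [OrderBot W] [CompactIccSpace W]
    (h : ∀ A : Set W, A.Countable → BddAbove A) : OmegaBounded W := by
  intro A hA
  obtain ⟨b, hb⟩ := h A hA
  refine (isCompact_Icc (a := ⊥) (b := b)).of_isClosed_subset isClosed_closure ?_
  exact closure_minimal (fun x hx => ⟨bot_le, hb hx⟩) isClosed_Icc

end LinearOrder

section LongCantor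

open Ordinal

instance orderBotIioOmegaOne : OrderBot (Iio (ω_ 1 : Ordinal.{0})) where
  bot := ⟨0, omega_pos 1⟩
  bot_le _ := Subtype.mk_le_mk.mpr zero_le

instance : NoMaxOrder (Iio (ω_ 1 : Ordinal.{0})) :=
  ⟨fun α => ⟨⟨Order.succ α.1, (Cardinal.isSuccLimit_omega 1).succ_lt α.2⟩, Order.lt_succ α.1⟩⟩

instance : LocallyCompactSpace (Iio (ω_ 1 : Ordinal.{0})) :=
  locallyCompactSpace_of_compactIccSpace

instance : NoncompactSpace (Iio (ω_ 1 : Ordinal.{0})) :=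
  noncompactSpace_of_noMaxOrder

theorem bddAbove_of_countable_Iio_omega_one {A : Set (Iio (ω_ 1 : Ordinal.{0}))}
    (hA : A.Countable) : BddAbove A := by
  have : Countable A := hA.to_subtype
  exact ⟨⟨⨆ β : A, β.1.1, iSup_lt_omega_one fun β => β.1.2⟩,
    fun β hβ => Ordinal.le_iSup (fun β : A => β.1.1) ⟨β, hβ⟩⟩

theorem omegaBounded_Iio_omega_one_prod_cantor :
    OmegaBounded (Iio (ω_ 1 : Ordinal.{0}) × (ℕ → Bool)) :=
  (omegaBounded_of_countable_bddAbove fun _ => bddAbove_of_countable_Iio_omega_one).prod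
    fun _ _ => isClosed_closure.isCompact

instance totallySeparatedSpace_longCantor : TotallySeparatedSpace LongCantor :=
  totallySeparatedSpace_onePoint

end LongCantor

section MSpace

variable {K : Type*}

/-- The embedding of `X` into `M(X, K)` as the slice `X × {y}`. -/
def mSpaceInfty (X : Set K) (x : X) : mSpace X :=
  ⟨(x, OnePoint.infty), Or.inr ⟨x.2, rfl⟩⟩

theorem range_mSpaceInfty (X : Set K) :
    range (mSpaceInfty X) = (↑) ⁻¹' (Prod.snd ⁻¹' {OnePoint.infty} : Set (K × LongCantor)) := by
  refine Subset.antisymm ?_ ?_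
  · rintro _ ⟨x, rfl⟩
    exact rfl
  · rintro ⟨⟨k, l⟩, hM⟩ (rfl : l = OnePoint.infty)
    rcases hM with hM | hM
    · exact (hM.2 rfl).elim
    · exact ⟨⟨k, hM.1⟩, rfl⟩

variable [TopologicalSpace K]

theorem isClosedEmbedding_mSpaceInfty (X : Set K) : IsClosedEmbedding (mSpaceInfty X) where
  toIsInducing := .of_comp (by unfold mSpaceInfty; fun_prop)
    (continuous_fst.comp continuous_subtype_val) IsInducing.subtypeVal
  injective _ _ h := Subtype.ext (congrArg (fun p => p.1.1) h)
  isClosed_range := by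
    rw [range_mSpaceInfty]
    exact isClosed_singleton.preimage (continuous_snd.comp continuous_subtype_val)

theorem dense_mSpace (X : Set K) : Dense (mSpace X) :=
  (dense_univ.prod (dense_compl_singleton _)).mono subset_union_left

theorem isNowhereDense_range_mSpaceInfty (X : Set K) :
    IsNowhereDense (range (mSpaceInfty X)) := by
  rw [range_mSpaceInfty]
  refine isNowhereDense_preimage_of_isDenseInducing (dense_mSpace X).isDenseInducing_val ?_
  rw [(isClosed_singleton.preimage continuous_snd).isNowhereDense_iff,
    ← isOpenMap_snd.preimage_interior_eq_interior_preimage continuous_snd, interior_singleton,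
    preimage_empty]

theorem OmegaNBounded.omegaBounded_of_mSpace {X : Set K} (h : OmegaNBounded (mSpace X)) :
    OmegaBounded X := by
  intro A (hA : A.Countable)
  have hcompact : IsCompact (closure (mSpaceInfty X '' A)) :=
    h _ ⟨hA.image _, (isNowhereDense_range_mSpaceInfty X).mono (image_subset_range _ _)⟩
  rw [(isClosedEmbedding_mSpaceInfty X).isInducing.closure_eq_preimage_closure_image]
  exact (isClosedEmbedding_mSpaceInfty X).isCompact_preimage hcompact

variable [CompactSpace K] [T2Space K]

theorem isCompact_closure_of_isSeparable_of_disjoint_infty {X : Set K} {A : Set (mSpace X)}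
    (hA : IsSeparable A) (hd : Disjoint A (range (mSpaceInfty X))) : IsCompact (closure A) := by
  have hsnd : OnePoint.infty ∉ closure (Prod.snd '' ((↑) '' A : Set (K × LongCantor))) := by
    refine infty_notMem_closure_of_isSeparable omegaBounded_Iio_omega_one_prod_cantor
      ((hA.image continuous_subtype_val).image continuous_snd) ?_
    rintro ⟨_, ⟨p, hp, rfl⟩, hinfty⟩
    exact hd.notMem_of_mem_left hp (by rw [range_mSpaceInfty]; exact hinfty)
  refine isCompact_closure_subtype_iff.mpr fun p hp => Or.inl ⟨mem_univ _, ?_⟩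
  exact ne_of_mem_of_not_mem (image_closure_subset_closure_image continuous_snd ⟨p, hp, rfl⟩) hsnd

theorem C2Bounded.mSpace {X : Set K} (hX : C2Bounded X) : C2Bounded (mSpace X) := by
  intro A hA
  let j := mSpaceInfty X
  have : SecondCountableTopology A := hA
  have hslice : IsCompact (closure (A ∩ range j)) := by
    have hE : IsCompact (closure (j ⁻¹' A)) :=
      hX _ (secondCountableSubspace_preimage (isClosedEmbedding_mSpaceInfty X).isInducing hA)
    rw [← image_preimage_eq_inter_range, (isClosedEmbedding_mSpaceInfty X).closure_image_eq]
    exact hE.image (isClosedEmbedding_mSpaceInfty X).continuous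
  have hrest : IsCompact (closure (A \ range j)) :=
    isCompact_closure_of_isSeparable_of_disjoint_infty
      ((IsSeparable.of_subtype A).mono sdiff_subset) disjoint_sdiff_left
  rw [← inter_union_sdiff A (range j), closure_union]
  exact hslice.union hrest

end MSpace

section Perturbation

variable {ι : Type*}

theorem exists_countable_dense_pi_bool (hι : Cardinal.mk ι ≤ Cardinal.continuum) :
    ∃ D : Set (ι → Bool), D.Countable ∧ Dense D := by
  classical
  obtain ⟨g⟩ : Nonempty (ι ↪ (ℕ → Bool)) := Cardinal.lift_mk_le'.mp (by simpa using hι)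
  have : Countable (Clopens (ℕ → Bool)) :=
    Clopens.countable_iff_secondCountable.mpr inferInstance
  refine ⟨range fun (C : Clopens (ℕ → Bool)) (i : ι) => decide (g i ∈ C),
    countable_range _, dense_iff_inter_open.mpr ?_⟩
  rintro U hU ⟨x, hx⟩
  obtain ⟨F, u, hu, hFU⟩ := isOpen_pi_iff.mp hU x hx
  have hfin : ∀ v : Bool, (g '' {i | i ∈ F ∧ x i = v}).Finite := fun v =>
    (F.finite_toSet.subset fun i hi => hi.1).image g
  obtain ⟨C, hC, htrue, hfalse⟩ := exists_clopen_of_closed_subset_open (hfin true).isClosed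
    (hfin false).isClosed.isOpen_compl (by
      rintro _ ⟨i, hi, rfl⟩ ⟨j, hj, hij⟩
      rw [g.injective hij] at hj
      exact Bool.false_ne_true (hj.2.symm.trans hi.2))
  refine ⟨_, hFU fun i hi => ?_, ⟨⟨C, hC⟩, rfl⟩⟩
  have hxi : decide (g i ∈ C) = x i := by
    cases h : x i with
    | true => exact decide_eq_true (htrue ⟨i, ⟨hi, h⟩, rfl⟩)
    | false => exact decide_eq_false fun hiC => hfalse hiC ⟨i, ⟨hi, h⟩, rfl⟩
  exact mem_of_eq_of_mem hxi (hu i hi).2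

variable {X : ι → Type*} {D : Type*} [TopologicalSpace D]

/-- `Φ` differs from `e` on a nowhere dense set in each coordinate separately; the set where
`Φ ≠ e` may well be everything. -/
def NowhereDensePerturbation (e Φ : D → ∀ i, X i) : Prop :=
  ∀ i, IsNowhereDense {d | Φ d i ≠ e d i}

namespace NowhereDensePerturbation

variable [∀ i, TopologicalSpace (X i)] {e Φ : D → ∀ i, X i}

theorem exists_isOpen_isNowhereDense_sdiff_preimage (h : NowhereDensePerturbation e Φ)
    (he : Continuous e) {U : Set (∀ i, X i)} (hU : IsOpen U) {d : D} (hd : e d ∈ U) :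
    ∃ O ⊆ e ⁻¹' U, IsOpen O ∧ d ∈ O ∧ IsNowhereDense (O \ Φ ⁻¹' U) := by
  obtain ⟨F, u, hu, hFU⟩ := isOpen_pi_iff.mp hU _ hd
  refine ⟨e ⁻¹' (F : Set ι).pi u, preimage_mono hFU,
    (isOpen_set_pi F.finite_toSet fun i hi => (hu i hi).1).preimage he, fun i hi => (hu i hi).2,
    (isNowhereDense_biUnion F.finite_toSet fun i _ => h i).mono ?_⟩
  rintro c ⟨hcF, hcU⟩
  by_contra hc
  simp only [mem_iUnion, not_exists] at hc
  refine hcU (hFU fun i hi => ?_)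
  rw [not_not.mp (hc i hi)]
  exact hcF i hi

theorem denseRange (h : NowhereDensePerturbation e Φ) (he : Continuous e) (hd : DenseRange e) :
    DenseRange Φ := by
  refine dense_iff_inter_open.mpr fun U hU hne => ?_
  obtain ⟨c, hc⟩ := hd.exists_mem_open hU hne
  obtain ⟨O, -, hO, hcO, hN⟩ := h.exists_isOpen_isNowhereDense_sdiff_preimage he hU hc
  obtain ⟨V, hVO, -, ⟨b, hb⟩, hVN⟩ := exists_isOpen_subset_disjoint hN hO ⟨c, hcO⟩
  have hbU : Φ b ∈ U := by
    by_contra hbU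
    exact disjoint_left.mp hVN hb ⟨hVO hb, hbU⟩
  exact ⟨Φ b, hbU, mem_range_self b⟩

theorem isNowhereDense_preimage (h : NowhereDensePerturbation e Φ) (he : IsDenseInducing e)
    {B : Set (∀ i, X i)} (hB : IsNowhereDense B) : IsNowhereDense (Φ ⁻¹' B) := by
  refine isNowhereDense_of_forall_exists_inter fun U hU ⟨c, hc⟩ => ?_
  obtain ⟨U', hU', rfl⟩ := he.isInducing.isOpen_iff.mp hU
  obtain ⟨V, hVU, hV, hne, hVB⟩ := exists_isOpen_subset_disjoint hB hU' ⟨e c, hc⟩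
  obtain ⟨d, hd⟩ := he.dense.exists_mem_open hV hne
  obtain ⟨O, hOV, hO, hdO, hN⟩ :=
    h.exists_isOpen_isNowhereDense_sdiff_preimage he.continuous hV hd
  exact ⟨O, hOV.trans (preimage_mono hVU), hO, ⟨d, hdO⟩,
    hN.mono (inter_subset_inter_right _ fun b hbB hbV => disjoint_left.mp hVB hbV hbB)⟩

end NowhereDensePerturbation

theorem nodec_range {Y : Type*} [TopologicalSpace Y] {Φ : D → Y}
    (hΦ : ∀ B : Set Y, IsNowhereDense B → IsNowhereDense (Φ ⁻¹' B))
    (hsep : ∀ A : Set D, IsNowhereDense A → ∀ p ∉ A, Φ p ∉ closure (Φ '' A)) :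
    Nodec (range Φ) := by
  intro B hB
  have himage : Φ '' (Φ ⁻¹' ((↑) '' B)) = (↑) '' B :=
    image_preimage_eq_of_subset (Subtype.coe_image_subset _ _)
  refine isClosed_of_closure_subset ?_
  rintro ⟨_, p, rfl⟩ hp
  rw [IsInducing.subtypeVal.closure_eq_preimage_closure_image] at hp
  by_contra hpB
  refine hsep _ (hΦ _ hB.image_val) p (fun hmem => ?_) (himage.symm ▸ hp)
  obtain ⟨b, hb, hbp⟩ := hmem
  obtain rfl : b = ⟨Φ p, mem_range_self p⟩ := Subtype.ext hbp
  exact hpB hb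

open Classical in
/-- Alters the points `e d` of the cube so that, for each nowhere dense set `A` and each `p ∉ A`,
every coordinate `i` with `g i = (A, p)` separates the new `p` from the new `A`. -/
noncomputable def separatingPerturbation (g : ι → Set D × D) (e : D → ι → Bool) (d : D) (i : ι) :
    Bool :=
  if IsNowhereDense (g i).1 then
    if d ∈ (g i).1 then false else if d = (g i).2 then true else e d i
  else e d i

theorem nowhereDensePerturbation_separatingPerturbation
    (hD : ∀ d : D, IsNowhereDense {d}) (g : ι → Set D × D) (e : D → ι → Bool) :
    NowhereDensePerturbation e (separatingPerturbation g e) := by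
  intro i
  by_cases hA : IsNowhereDense (g i).1
  · refine (isNowhereDense_union hA (hD (g i).2)).mono fun d hd => ?_
    by_contra hnot
    simp only [mem_union, mem_singleton_iff, not_or] at hnot
    exact hd (by simp only [separatingPerturbation, if_pos hA, if_neg hnot.1, if_neg hnot.2])
  · simp only [separatingPerturbation, if_neg hA, ne_eq, not_true_eq_false, ofPred_false,
      isNowhereDense_empty]

theorem separatingPerturbation_notMem_closure_image {g : ι → Set D × D}
    (hg : Function.Surjective g) (e : D → ι → Bool) {A : Set D} (hA : IsNowhereDense A) {p : D}
    (hp : p ∉ A) :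
    separatingPerturbation g e p ∉ closure (separatingPerturbation g e '' A) := by
  obtain ⟨i, hi⟩ := hg (A, p)
  obtain ⟨rfl, rfl⟩ : (g i).1 = A ∧ (g i).2 = p := Prod.ext_iff.mp hi
  have hclosed : IsClosed {y : ι → Bool | y i = false} :=
    isClosed_singleton.preimage (continuous_apply i)
  have hfalse : separatingPerturbation g e '' (g i).1 ⊆ {y | y i = false} := by
    rintro _ ⟨d, hd, rfl⟩
    simp only [separatingPerturbation, mem_ofPred_eq, if_pos hA, if_pos hd]
  have htrue : separatingPerturbation g e (g i).2 i = true := by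
    simp only [separatingPerturbation, if_pos hA, if_neg hp, if_true]
  exact fun h => Bool.false_ne_true ((closure_minimal hfalse hclosed h).symm.trans htrue)

theorem exists_surjective_set_prod (hι : Cardinal.continuum ≤ Cardinal.mk ι) (D : Type*)
    [Countable D] [Nonempty D] : ∃ g : ι → Set D × D, Function.Surjective g := by
  have hset : Cardinal.mk (Set D) ≤ Cardinal.continuum := by
    rw [Cardinal.mk_set, ← Cardinal.two_power_aleph0]
    exact Cardinal.power_le_power_left two_ne_zero Cardinal.mk_le_aleph0
  have hprod : Cardinal.mk (Set D × D) ≤ Cardinal.continuum := by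
    rw [Cardinal.mk_prod, Cardinal.lift_id, Cardinal.lift_id, ← Cardinal.continuum_mul_aleph0]
    exact mul_le_mul' hset Cardinal.mk_le_aleph0
  obtain ⟨f⟩ : Nonempty (Set D × D ↪ ι) := Cardinal.lift_mk_le'.mp
    ((Cardinal.lift_le_continuum.mpr hprod).trans (Cardinal.continuum_le_lift.mpr hι))
  exact ⟨Function.invFun f, Function.invFun_surjective f.injective⟩

theorem exists_countable_dense_nodec (hι : Cardinal.mk ι = Cardinal.continuum) :
    ∃ S : Set (ι → Bool), S.Countable ∧ Dense S ∧ Nodec S := by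
  obtain ⟨D, hDc, hD⟩ := exists_countable_dense_pi_bool hι.le
  have : Countable D := hDc.to_subtype
  have : Nonempty D := hD.nonempty.to_subtype
  have : Uncountable ι := Cardinal.aleph0_lt_mk_iff.mp (hι ▸ Cardinal.aleph0_lt_continuum)
  have : ∀ x : ι → Bool, (𝓝[≠] x).NeBot := fun x =>
    nhdsNE_neBot_of_not_isCountablyGenerated (not_isCountablyGenerated_nhds_pi x)
  have hsingleton : ∀ d : D, IsNowhereDense {d} := fun d =>
    (isNowhereDense_preimage_of_isDenseInducing hD.isDenseInducing_val
      (isNowhereDense_singleton d.1)).mono fun _ h => congrArg Subtype.val h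
  obtain ⟨g, hg⟩ := exists_surjective_set_prod hι.ge D
  have hΦ := nowhereDensePerturbation_separatingPerturbation hsingleton g ((↑) : D → ι → Bool)
  exact ⟨range (separatingPerturbation g (↑)), countable_range _,
    hΦ.denseRange continuous_subtype_val hD.denseRange_val,
    nodec_range (fun _ => hΦ.isNowhereDense_preimage hD.isDenseInducing_val)
      fun _ hA _ => separatingPerturbation_notMem_closure_image hg _ hA⟩

end Perturbation

theorem mainTheorem11_general {K : Type*} [TopologicalSpace K] [CompactSpace K] [T2Space K]
    [TotallyDisconnectedSpace K] (hK : ∀ x : K, ¬ (𝓝 x).IsCountablyGenerated) {S : Set K}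
    (hSc : S.Countable) (hSd : Dense S) (hSn : Nodec S) {a : K} (ha : a ∈ S) :
    let X : Set K := pClosure OmegaN (S \ {a})
    (ZeroDimensional X ∧ OmegaNBounded X ∧ C2Bounded X ∧ ¬ OmegaBounded X) ∧ Dense X ∧
      (ZeroDimensional (mSpace X) ∧ C2Bounded (mSpace X) ∧ ¬ OmegaNBounded (mSpace X)) := by
  intro X
  have : ∀ x : K, (𝓝[≠] x).NeBot := fun x => nhdsNE_neBot_of_not_isCountablyGenerated (hK x)
  have : SeparableSpace K := ⟨S, hSc, hSd⟩
  have hSX : S \ {a} ⊆ X := subset_pClosure_omegaN _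
  have hSad : Dense (S \ {a}) := hSd.sdiff_singleton a
  have hXd : Dense X := hSad.mono hSX
  have hXN : OmegaNBounded X := omegaNBounded_pClosure_omegaN _
  have hXchar : ∀ x : X, ¬ (𝓝 x).IsCountablyGenerated := fun x _ =>
    hK x (isCountablyGenerated_nhds_of_isDenseInducing hXd.isDenseInducing_val x)
  have hXC : C2Bounded X := hXN.c2Bounded fun A hA =>
    have : SecondCountableTopology A := hA
    isNowhereDense_of_firstCountableTopology hXchar A
  have haX : a ∉ X := hSn.notMem_pClosure_omegaN hSd ha
  have hXω : ¬ OmegaBounded X := fun h =>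
    haX (eq_univ_iff_forall.mp (eq_univ_of_omegaBounded h hSX (hSc.mono sdiff_subset) hSad) a)
  exact ⟨⟨zeroDimensional_subtype X, hXN, hXC, hXω⟩, hXd,
    zeroDimensional_subtype (mSpace X), hXC.mSpace, fun h => hXω h.omegaBounded_of_mSpace⟩

theorem mainTheorem11 (ι : Type*) (hι : Cardinal.mk ι = Cardinal.continuum) :
    (∃ S : Set (ι → Bool), S.Countable ∧ Dense S ∧ Nodec S) ∧
    ∀ S : Set (ι → Bool), S.Countable → Dense S → Nodec S → ∀ a ∈ S,
      ∀ X : Set (ι → Bool), X = pClosure OmegaN (S \ {a}) →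
        (ZeroDimensional X ∧ OmegaNBounded X ∧ C2Bounded X ∧ ¬ OmegaBounded X) ∧
        -- so that the compact space `2^ι` is a compactification of `X`
        Dense X ∧
        (ZeroDimensional (mSpace X) ∧ C2Bounded (mSpace X) ∧ ¬ OmegaNBounded (mSpace X)) := by
  have : Uncountable ι := Cardinal.aleph0_lt_mk_iff.mp (hι ▸ Cardinal.aleph0_lt_continuum)
  refine ⟨exists_countable_dense_nodec hι, fun S hSc hSd hSn a ha X hX => ?_⟩
  subst hX
  exact mainTheorem11_general not_isCountablyGenerated_nhds_pi hSc hSd hSn ha
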